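/- **Theorem 4.1.** Let $k \ge 2$ and let $\Sigma=\{a_1,\dots,a_k\}$ be an alphabet of $k$ distinct letters. *Grammars.* A linear GF(2)-grammar is a context-free grammar over $\Sigma$ with finitely many rules, all of the form $A\to w$ or $A\to xBy$ ($w,x,y\in\Sigma^*$, $B$ a nonterminal), such that every $w\in\Sigma^*$ has only finitely many parse trees with the initial symbol at the root. It describes the language of all strings with an odd number of such parse trees. *Series.* A language $K\subseteq a_1^*a_2^*\cdots a_k^*$ is identified with the formal power series in $\mathbb F_2[[a_1,\dots,a_k]]$ in which the coefficient of $a_1^{n_1}\cdots a_k^{n_k}$ is $1$ if the word $a_1^{n_1}\cdots a_k^{n_k}$ lies in $K$, and $0$ otherwise. *Path-like sets.* Let $X_k=\{(i,j) : 1\le i<j\le k\}$. A set $Y\subseteq X_k$ is path-like if it can be obtained by the following process, started from the segment $[\ell,r]=[1,k]$: add $(\ell,r)$ to $Y$; if $r-\ell=1$, stop; if $r-\ell\ge 2$, choose one of the segments $[\ell,r-1]$ and $[\ell+1,r]$ and continue with it. *Denominators.* For $Y\subseteq X_k$, let $\operatorname{withinv}(\mathbb F_2[a_1,\dots,a_k],Y)$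 be the set of all $f \in \mathbb F_2[[a_1,\dots,a_k]]$ of the form $$f=\frac{t}{\prod_{(i,j)\in Y}p_{(i,j)}},$$ where $t\in\mathbb F_2[a_1,\dots,a_k]$ and each $p_{(i,j)}\in\mathbb F_2[a_i,a_j]$ is a polynomial that is invertible as a power series (that is, has constant term $1$). *Claim.* If $K\subseteq a_1^*a_2^*\cdots a_k^*$ is described by a linear GF(2)-grammar over $\Sigma$, then the power series of $K$ can be written as $$K=\sum_{Y\ \text{path-like}} f_Y,\qquad f_Y\in\operatorname{withinv}(\mathbb F_2[a_1,\dots,a_k],Y),$$ with one (possibly zero) summand for each path-like set $Y\subseteq X_k$. -/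

import Mathlib

namespace GF2

universe u

/-- Parse forests of a context-free grammar `g`. A forest over a string `s` of terminals and
nonterminals consists of one parse tree for every nonterminal occurring in `s`, and the root of such
a tree carries a rule of `g` for this nonterminal together with a forest over the right-hand side of
that rule. -/
inductive ParseForest {T : Type u} (g : ContextFreeGrammar T) :
    List (Symbol T g.NT) → Type u
  | nil : ParseForest g []
  | terminal {s : List (Symbol T g.NT)} (a : T) (rest : ParseForest g s) :
      ParseForest g (Symbol.terminal a :: s)
  | nonterminal {s : List (Symbol T g.NT)} (A : g.NT) (r : ContextFreeRule T g.NT)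
      (hr : r ∈ g.rules) (hA : r.input = A) (children : ParseForest g r.output)
      (rest : ParseForest g s) : ParseForest g (Symbol.nonterminal A :: s)

/-- The string of terminals at the leaves of a parse forest, from left to right. -/
def ParseForest.yield {T : Type u} {g : ContextFreeGrammar T} :
    {s : List (Symbol T g.NT)} → ParseForest g s → List T
  | _, .nil => []
  | _, .terminal a rest => a :: rest.yield
  | _, .nonterminal _ _ _ _ children rest => children.yield ++ rest.yield

/-- The parse trees of the string `w` in `g`, with root labelled by the initial symbol. -/
def parseTrees {T : Type u} (g : ContextFreeGrammar T) (w : List T) :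
    Set (ParseForest g [Symbol.nonterminal g.initial]) :=
  {t | t.yield = w}

/-- A grammar is well-formed as a GF(2)-grammar if every string has finitely many parse trees. -/
def IsWellFormed {T : Type u} (g : ContextFreeGrammar T) : Prop :=
  ∀ w : List T, (parseTrees g w).Finite

/-- The language described by `g`, read as a GF(2)-grammar: the set of all strings with an odd
number of parse trees. -/
def language {T : Type u} (g : ContextFreeGrammar T) : Language T :=
  {w | Odd (parseTrees g w).ncard}

/-- A grammar is linear if every rule is of the form `A → w` or `A → x B y`, where `w`, `x`, `y` are
strings of terminals and `B` is a nonterminal. -/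
def IsLinear {T : Type u} (g : ContextFreeGrammar T) : Prop :=
  ∀ r ∈ g.rules,
    (∃ w : List T, r.output = w.map Symbol.terminal) ∨
    (∃ (x : List T) (B : g.NT) (y : List T),
      r.output = x.map Symbol.terminal ++ Symbol.nonterminal B :: y.map Symbol.terminal)

/-- `K` is described by a linear GF(2)-grammar. -/
def IsDescribedByLinearGrammar {T : Type u} (K : Language T) : Prop :=
  ∃ g : ContextFreeGrammar T, IsLinear g ∧ IsWellFormed g ∧ language g = K

/-- The word `a_1 ^ n_1 ⋯ a_k ^ n_k`; the letter with index `i : Fin k` is `a_{i+1}`. -/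
def boundedWord {k : ℕ} (n : Fin k →₀ ℕ) : List (Fin k) :=
  (List.finRange k).flatMap fun i => List.replicate (n i) i

/-- The language `a_1^* a_2^* ⋯ a_k^*`. -/
def boundedLanguage (k : ℕ) : Language (Fin k) := Set.range boundedWord

open Classical in
/-- The power series over the two-element field that corresponds to a subset `K` of
`a_1^* a_2^* ⋯ a_k^*`: the coefficient of `a_1 ^ n_1 ⋯ a_k ^ n_k` is `1` if this word lies in `K`,
and `0` otherwise. -/
noncomputable def toSeries {k : ℕ} (K : Language (Fin k)) : MvPowerSeries (Fin k) (ZMod 2) :=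
  fun n => if boundedWord n ∈ K then 1 else 0

/-- The ring of polynomials in `a_1, …, a_k`, inside the ring of power series. -/
noncomputable def polynomials (k : ℕ) : Subring (MvPowerSeries (Fin k) (ZMod 2)) :=
  (MvPolynomial.coeToMvPowerSeries.ringHom (σ := Fin k) (R := ZMod 2)).range

/-- The set of all power series of the form `t / ∏_{(i, j) ∈ Y} p_{(i, j)}`, where `t` lies in `T`
and every `p_{(i, j)}` is a polynomial in the variables `a_i`, `a_j` only that is invertible as a
power series. -/
def withinv {k : ℕ} (T : Subring (MvPowerSeries (Fin k) (ZMod 2)))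
    (Y : Finset (Fin k × Fin k)) : Set (MvPowerSeries (Fin k) (ZMod 2)) :=
  {f | ∃ t ∈ T, ∃ p : Fin k × Fin k → MvPolynomial (Fin k) (ZMod 2),
    (∀ e ∈ Y, p e ∈ MvPolynomial.supported (ZMod 2) {e.1, e.2} ∧
      IsUnit (p e : MvPowerSeries (Fin k) (ZMod 2))) ∧
    f * ∏ e ∈ Y, (p e : MvPowerSeries (Fin k) (ZMod 2)) = t}

/-- `PathLikeOn l r Y` says that `Y` can be obtained by the following process, started from the
segment `[l, r]`. Add the pair of end points of the current segment to `Y`; stop if the segment has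
length one, and otherwise shorten it by one, at its right or at its left end, and continue. -/
inductive PathLikeOn {k : ℕ} : Fin k → Fin k → Finset (Fin k × Fin k) → Prop
  | base (l r : Fin k) (h : (l : ℕ) + 1 = r) : PathLikeOn l r {(l, r)}
  | shortenRight (l r r' : Fin k) (Y : Finset (Fin k × Fin k)) (h : (l : ℕ) + 2 ≤ r)
      (hr : (r' : ℕ) + 1 = r) (hY : PathLikeOn l r' Y) : PathLikeOn l r (insert (l, r) Y)
  | shortenLeft (l r l' : Fin k) (Y : Finset (Fin k × Fin k)) (h : (l : ℕ) + 2 ≤ r)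
      (hl : (l : ℕ) + 1 = l') (hY : PathLikeOn l' r Y) : PathLikeOn l r (insert (l, r) Y)

/-- A path-like set: the outcome of the process above, started from the whole segment `[1, k]`. -/
def IsPathLike {k : ℕ} (Y : Finset (Fin k × Fin k)) : Prop :=
  ∃ l r : Fin k, (l : ℕ) = 0 ∧ (r : ℕ) + 1 = k ∧ PathLikeOn l r Y

open Classical in
/-- The finite collection of all path-like sets. -/
noncomputable def pathLikeSets (k : ℕ) : Finset (Finset (Fin k × Fin k)) :=
  Finset.univ.filter IsPathLike

end GF2

/-!
A sorted word is read by a deterministic automaton whose state is the last letter read. For a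
nonterminal `A` and letters `l ≤ r`, let `F A l r` be the power series that counts, modulo 2, the
parse trees with root `A` whose yields run from state `l` to state `r` (`ntSeries`). Splitting a tree
at its root rule `A → x B y`, and the run on its yield at the two ends of the yield of `B`, expresses
`F A l r` as a polynomial plus a combination, with monomial coefficients, of series `F B l' r'` with
`l ≤ l'` and `r' ≤ r` (`runSeries_context`, `hasExpansion_ntSeries`).

The terms with `[l', r'] = [l, r]` come from rules with `x` a power of the letter `l` and `y` a power
of the letter `r`. So, for fixed `[l, r]`, the series `F A l r` solve a linear system with matrix
`1 - M`, where `M` has entries in the polynomials in the letters `l` and `r`, and with a right-hand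
side built from shorter segments. By Cramer's rule, every passage to a larger segment costs one
division by a polynomial in its two end letters. The segments met along a chain of inclusions extend
to a path-like set, which gives the claimed shape (`mem_pathLikeSums_of_hasExpansion`).

The determinant of `1 - M` must be invertible as a power series. Its constant term is
`det (1 - M₀)`, where `M₀` counts the rules `A → B`. Only nonterminals that have parse trees, but
finitely many for each string, enter the system. On these the rules `A → B` are acyclic, since a cycle
would give infinitely many trees with the same yield (`not_transGen_unitRule_self`). Hence `1 - M₀` has
trivial kernel (`det_one_sub_ne_zero`).
-/

namespace GF2

universe u

/-- The ring of polynomials in the `k` letters over the two-element field. -/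
abbrev PolyRing (k : ℕ) := MvPolynomial (Fin k) (ZMod 2)

/-- The ring of formal power series in the `k` letters over the two-element field. -/
abbrev SeriesRing (k : ℕ) := MvPowerSeries (Fin k) (ZMod 2)

/-! ### Sums of fractions with path-like denominators -/

theorem coe_mem_polynomials {k : ℕ} (p : PolyRing k) : (p : SeriesRing k) ∈ polynomials k :=
  ⟨p, rfl⟩

theorem prod_coe_mem_polynomials {k : ℕ} (Y : Finset (Fin k × Fin k))
    (p : Fin k × Fin k → PolyRing k) : ∏ e ∈ Y, (p e : SeriesRing k) ∈ polynomials k :=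
  Subring.prod_mem _ fun e _ => coe_mem_polynomials (p e)

theorem smul_eq_coe_mul {k : ℕ} (p : PolyRing k) (f : SeriesRing k) :
    p • f = (p : SeriesRing k) * f :=
  Algebra.smul_def p f

/-- The set `withinv (polynomials k) Y` as a module over the ring of polynomials. -/
noncomputable def withinvSubmodule {k : ℕ} (Y : Finset (Fin k × Fin k)) :
    Submodule (PolyRing k) (SeriesRing k) where
  carrier := withinv (polynomials k) Y
  zero_mem' := ⟨0, Subring.zero_mem _, 1,
    fun e _ => ⟨Subalgebra.one_mem _, by simp⟩, by simp⟩
  add_mem' := by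
    rintro f g ⟨t, ht, p, hp, hf⟩ ⟨u, hu, q, hq, hg⟩
    refine ⟨t * ∏ e ∈ Y, (q e : SeriesRing k) + u * ∏ e ∈ Y, (p e : SeriesRing k),
      Subring.add_mem _ (Subring.mul_mem _ ht (prod_coe_mem_polynomials Y q))
        (Subring.mul_mem _ hu (prod_coe_mem_polynomials Y p)), fun e => p e * q e,
      fun e he => ⟨Subalgebra.mul_mem _ (hp e he).1 (hq e he).1, ?_⟩, ?_⟩
    · rw [MvPolynomial.coe_mul]
      exact (hp e he).2.mul (hq e he).2
    · simp only [MvPolynomial.coe_mul, Finset.prod_mul_distrib]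
      rw [← hf, ← hg]
      ring
  smul_mem' := by
    rintro c f ⟨t, ht, p, hp, hf⟩
    refine ⟨c * t, Subring.mul_mem _ (coe_mem_polynomials c) ht, p, hp, ?_⟩
    rw [smul_eq_coe_mul, mul_assoc, hf]

theorem coe_mem_withinvSubmodule {k : ℕ} (Y : Finset (Fin k × Fin k)) (t : PolyRing k) :
    (t : SeriesRing k) ∈ withinvSubmodule Y :=
  ⟨t, coe_mem_polynomials t, 1, fun e _ => ⟨Subalgebra.one_mem _, by simp⟩, by simp⟩

theorem withinvSubmodule_le_insert {k : ℕ} (Y : Finset (Fin k × Fin k)) (e : Fin k × Fin k) :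
    withinvSubmodule Y ≤ withinvSubmodule (insert e Y) := by
  classical
  rintro f ⟨t, ht, p, hp, hf⟩
  by_cases he : e ∈ Y
  · rw [Finset.insert_eq_of_mem he]
    exact ⟨t, ht, p, hp, hf⟩
  · refine ⟨t, ht, Function.update p e 1, fun e' he' => ?_, ?_⟩
    · rcases Finset.mem_insert.1 he' with rfl | h
      · simp only [Function.update_self]
        exact ⟨Subalgebra.one_mem _, by simp⟩
      · rw [Function.update_of_ne (ne_of_mem_of_not_mem h he)]
        exact hp e' h
    · rw [Finset.prod_insert he, Function.update_self, MvPolynomial.coe_one, one_mul, ← hf]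
      congr 1
      refine Finset.prod_congr rfl fun e' he' => ?_
      rw [Function.update_of_ne (ne_of_mem_of_not_mem he' he)]

/-- A fraction may be divided further by a polynomial in the letters of a pair of `Y`, since this
polynomial can be absorbed into the factor of the denominator that belongs to the pair. -/
theorem mul_mem_withinvSubmodule {k : ℕ} {Y : Finset (Fin k × Fin k)} {e : Fin k × Fin k}
    (he : e ∈ Y) {q : PolyRing k} (hq : q ∈ MvPolynomial.supported (ZMod 2) {e.1, e.2})
    {q' : SeriesRing k} (hqq' : (q : SeriesRing k) * q' = 1) {f : SeriesRing k}
    (hf : f ∈ withinvSubmodule Y) : q' * f ∈ withinvSubmodule Y := by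
  classical
  obtain ⟨t, ht, p, hp, hf⟩ := hf
  refine ⟨t, ht, Function.update p e (q * p e), fun e' he' => ?_, ?_⟩
  · by_cases h : e' = e
    · subst h
      rw [Function.update_self, MvPolynomial.coe_mul]
      exact ⟨Subalgebra.mul_mem _ hq (hp _ he).1, (IsUnit.of_mul_eq_one _ hqq').mul (hp _ he).2⟩
    · rw [Function.update_of_ne h]
      exact hp e' he'
  · rw [← hf, ← Finset.mul_prod_erase Y _ he, ← Finset.mul_prod_erase Y _ he, Function.update_self,
      MvPolynomial.coe_mul]
    have : ∏ e' ∈ Y.erase e, ((Function.update p e (q * p e) e' : PolyRing k) : SeriesRing k) =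
        ∏ e' ∈ Y.erase e, (p e' : SeriesRing k) :=
      Finset.prod_congr rfl fun e' he' => by
        rw [Function.update_of_ne (Finset.ne_of_mem_erase he')]
    rw [this]
    linear_combination (f * (p e : SeriesRing k) * ∏ e' ∈ Y.erase e, (p e' : SeriesRing k)) * hqq'

/-- The module of all sums of fractions whose denominators belong to path-like sets on the
segment `[L, R]`. -/
noncomputable def pathLikeSums {k : ℕ} (L R : Fin k) : Submodule (PolyRing k) (SeriesRing k) :=
  ⨆ (Y : Finset (Fin k × Fin k)) (_ : PathLikeOn L R Y), withinvSubmodule Y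

theorem PathLikeOn.mem {k : ℕ} {L R : Fin k} {Y : Finset (Fin k × Fin k)}
    (h : PathLikeOn L R Y) : (L, R) ∈ Y := by
  cases h <;> simp

theorem exists_pathLikeOn {k : ℕ} (L R : Fin k) (h : L < R) : ∃ Y, PathLikeOn L R Y := by
  obtain ⟨n, hn⟩ : ∃ n : ℕ, (L : ℕ) + 1 + n = R := ⟨R - (L + 1), by omega⟩
  induction n generalizing R with
  | zero => exact ⟨_, .base L R hn⟩
  | succ n ih =>
    obtain ⟨Y, hY⟩ := ih ⟨L + 1 + n, by omega⟩ (Fin.lt_def.2 (by simp; omega)) rfl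
    exact ⟨_, .shortenRight L R _ Y (by omega) (by simp; omega) hY⟩

theorem coe_mem_pathLikeSums {k : ℕ} {L R : Fin k} (h : L < R) (t : PolyRing k) :
    (t : SeriesRing k) ∈ pathLikeSums L R := by
  obtain ⟨Y, hY⟩ := exists_pathLikeOn L R h
  exact le_iSup₂_of_le (f := fun Y (_ : PathLikeOn L R Y) => withinvSubmodule Y) Y hY le_rfl
    (coe_mem_withinvSubmodule Y t)

theorem mem_pathLikeSums_of_mul_mem {k : ℕ} {L R : Fin k} {q : PolyRing k}
    (hq : q ∈ MvPolynomial.supported (ZMod 2) {L, R}) (hu : IsUnit (q : SeriesRing k))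
    {f : SeriesRing k} (hf : (q : SeriesRing k) * f ∈ pathLikeSums L R) :
    f ∈ pathLikeSums L R := by
  obtain ⟨q', hqq'⟩ := hu.exists_right_inv
  have key : pathLikeSums L R ≤
      (pathLikeSums L R).comap (LinearMap.mulLeft (PolyRing k) q') := by
    refine iSup₂_le fun Y hY g hg => ?_
    exact le_iSup₂_of_le (f := fun Y (_ : PathLikeOn L R Y) => withinvSubmodule Y) Y hY le_rfl
      (mul_mem_withinvSubmodule hY.mem hq hqq' hg)
  have := key hf
  rw [Submodule.mem_comap, LinearMap.mulLeft_apply, ← mul_assoc, mul_comm q', hqq', one_mul] at this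
  exact this

theorem pathLikeSums_mono {k : ℕ} {L R L' R' : Fin k} (hL : L ≤ L') (h : L' < R') (hR : R' ≤ R) :
    pathLikeSums L' R' ≤ pathLikeSums L R := by
  obtain ⟨n, hn⟩ : ∃ n : ℕ, (L' - L : ℕ) + (R - R' : ℕ) = n := ⟨_, rfl⟩
  induction n generalizing L R with
  | zero =>
    obtain rfl : L = L' := Fin.ext (by omega)
    obtain rfl : R = R' := Fin.ext (by omega)
    exact le_rfl
  | succ n ih =>
    rcases hL.lt_or_eq with hlt | rfl
    · refine (ih (L := ⟨L + 1, by omega⟩) (R := R) (Fin.le_def.2 (by simp; omega)) hR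
        (by simp; omega)).trans (iSup₂_le fun Y hY => ?_)
      exact le_iSup₂_of_le _ (.shortenLeft L R _ Y (by omega) rfl hY)
        (withinvSubmodule_le_insert Y _)
    · refine (ih (L := L) (R := ⟨R - 1, by omega⟩) le_rfl (Fin.le_def.2 (by simp; omega))
        (by simp; omega)).trans (iSup₂_le fun Y hY => ?_)
      exact le_iSup₂_of_le _ (.shortenRight L R _ Y (by omega) (by simp; omega) hY)
        (withinvSubmodule_le_insert Y _)

theorem exists_withinv_of_mem_pathLikeSums {k : ℕ} {L R : Fin k} (hL : (L : ℕ) = 0)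
    (hR : (R : ℕ) + 1 = k) {s : SeriesRing k} (hs : s ∈ pathLikeSums L R) :
    ∃ f : Finset (Fin k × Fin k) → SeriesRing k,
      (∀ Y ∈ pathLikeSets k, f Y ∈ withinv (polynomials k) Y) ∧ s = ∑ Y ∈ pathLikeSets k, f Y := by
  have hle : pathLikeSums L R ≤ ⨆ Y ∈ pathLikeSets k, withinvSubmodule Y := by
    refine iSup₂_le fun Y hY => le_iSup₂_of_le Y ?_ le_rfl
    simp only [pathLikeSets, Finset.mem_filter, Finset.mem_univ, true_and]
    exact ⟨L, R, hL, hR, hY⟩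
  obtain ⟨μ, hμ⟩ := (Submodule.mem_iSup_finset_iff_exists_sum _ _).1 (hle hs)
  exact ⟨fun Y => μ Y, fun Y _ => (μ Y).2, hμ.symm⟩

/-! ### Triangular linear systems over the segments -/

/-- The series `f`, attached to the segment `[l, r]`, is a polynomial plus a combination of the
series `G l' r' j` of the subsegments `[l', r']`. The coefficients that belong to `[l, r]` itself
involve only the letters `l` and `r`, and have constant term `0` unless `E j` holds. -/
def HasExpansion {k : ℕ} {ι : Type*} [Fintype ι] (G : Fin k → Fin k → ι → SeriesRing k)
    (E : ι → Prop) (l r : Fin k) (f : SeriesRing k) : Prop :=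
  ∃ (t : PolyRing k) (M : Fin k × Fin k → ι → PolyRing k),
    (∀ p j, M p j ≠ 0 → l ≤ p.1 ∧ p.2 ≤ r) ∧
    (∀ j, M (l, r) j ∈ MvPolynomial.supported (ZMod 2) {l, r}) ∧
    (∀ j, MvPolynomial.constantCoeff (M (l, r) j) ≠ 0 → E j) ∧
    f = t + ∑ p, ∑ j, (M p j : SeriesRing k) * G p.1 p.2 j

theorem HasExpansion.coe {k : ℕ} {ι : Type*} [Fintype ι] {G : Fin k → Fin k → ι → SeriesRing k}
    {E : ι → Prop} {l r : Fin k} (t : PolyRing k) : HasExpansion G E l r t :=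
  ⟨t, 0, by simp, by simp, by simp, by simp⟩

theorem HasExpansion.add {k : ℕ} {ι : Type*} [Fintype ι] {G : Fin k → Fin k → ι → SeriesRing k}
    {E : ι → Prop} {l r : Fin k} {f g : SeriesRing k} (hf : HasExpansion G E l r f)
    (hg : HasExpansion G E l r g) : HasExpansion G E l r (f + g) := by
  obtain ⟨t, M, h1, h2, h3, rfl⟩ := hf
  obtain ⟨u, N, g1, g2, g3, rfl⟩ := hg
  refine ⟨t + u, M + N, fun p j h => ?_, fun j => Subalgebra.add_mem _ (h2 j) (g2 j),
    fun j h => ?_, ?_⟩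
  · by_cases hM : M p j = 0
    · exact g1 p j fun hN => h (by simp [hM, hN])
    · exact h1 p j hM
  · by_cases hM : MvPolynomial.constantCoeff (M (l, r) j) = 0
    · exact g3 j fun hN => h (by simp [hM, hN])
    · exact h3 j hM
  · simp only [Pi.add_apply, MvPolynomial.coe_add, add_mul, Finset.sum_add_distrib]
    ring

theorem HasExpansion.sum {k : ℕ} {ι α : Type*} [Fintype ι]
    {G : Fin k → Fin k → ι → SeriesRing k} {E : ι → Prop} {l r : Fin k} (s : Finset α)
    {f : α → SeriesRing k} (hf : ∀ a ∈ s, HasExpansion G E l r (f a)) :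
    HasExpansion G E l r (∑ a ∈ s, f a) := by
  classical
  induction s using Finset.induction_on with
  | empty => simpa using HasExpansion.coe (G := G) (E := E) (l := l) (r := r) 0
  | insert a s ha ih =>
    rw [Finset.sum_insert ha]
    exact (hf a (Finset.mem_insert_self a s)).add
      (ih fun b hb => hf b (Finset.mem_insert_of_mem hb))

/-- The determinant of `1 - B` is invertible if the nonzero entries of `B` go along the edges of a
well-founded relation: no nonzero vector is fixed by `B`. -/
theorem det_one_sub_ne_zero {ι F : Type*} [Fintype ι] [DecidableEq ι] [Field F]
    {E : ι → ι → Prop} (hE : WellFounded fun j i => E i j) {B : Matrix ι ι F}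
    (hB : ∀ i j, B i j ≠ 0 → E i j) : (1 - B).det ≠ 0 := by
  intro hdet
  obtain ⟨v, hv, hv0⟩ := Matrix.exists_mulVec_eq_zero_iff.2 hdet
  refine hv (funext fun i => hE.induction (C := fun i => v i = 0) i fun i ih => ?_)
  have h := congrFun hv0 i
  rw [Matrix.sub_mulVec, Matrix.one_mulVec, Pi.sub_apply, Pi.zero_apply, sub_eq_zero] at h
  rw [h]
  refine Finset.sum_eq_zero fun j _ => ?_
  by_cases hij : B i j = 0
  · simp [hij]
  · simp [ih j (hB i j hij)]

theorem det_mem_subalgebra {R A ι : Type*} [CommRing R] [CommRing A] [Algebra R A] [Fintype ι]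
    [DecidableEq ι] (S : Subalgebra R A) {B : Matrix ι ι A} (hB : ∀ i j, B i j ∈ S) :
    B.det ∈ S := by
  rw [Matrix.det_apply]
  refine Subalgebra.sum_mem _ fun σ _ => ?_
  rw [Units.smul_def]
  exact zsmul_mem (Subalgebra.prod_mem _ fun i _ => hB _ _) _

/-- Solving the system for `[l, r]` by Cramer's rule divides once by a determinant in the letters
`l` and `r`; everything else comes from shorter segments. -/
theorem mem_pathLikeSums_of_hasExpansion {k : ℕ} {ι : Type*} [Fintype ι]
    {G : Fin k → Fin k → ι → SeriesRing k} {E : ι → ι → Prop}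
    (hE : WellFounded fun j i => E i j) (hG0 : ∀ l r i, ¬ l ≤ r → G l r i = 0)
    (hG : ∀ l r i, HasExpansion G (E i) l r (G l r i)) {L R l r : Fin k} (hLR : L < R)
    (hl : L ≤ l) (hr : r ≤ R) (i : ι) : G l r i ∈ pathLikeSums L R := by
  classical
  by_cases hlr : l ≤ r
  swap
  · rw [hG0 l r i hlr]
    exact Submodule.zero_mem _
  obtain ⟨n, hn⟩ : ∃ n : ℕ, (r - l : ℕ) = n := ⟨_, rfl⟩
  induction n using Nat.strong_induction_on generalizing L R l r i with
  | _ n ih =>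
  -- A one-letter segment contributes its denominator to a pair that has this letter as an end.
  obtain ⟨L', R', hLR', hL', hR', hlL', hrR', hsub⟩ : ∃ L' R' : Fin k, L' < R' ∧ L ≤ L' ∧ R' ≤ R ∧
      L' ≤ l ∧ r ≤ R' ∧ ({l, r} : Set (Fin k)) ⊆ {L', R'} := by
    rcases hlr.lt_or_eq with h | rfl
    · exact ⟨l, r, h, hl, hr, le_rfl, le_rfl, subset_rfl⟩
    · rcases hr.lt_or_eq with h | rfl
      · exact ⟨l, R, h, hl, le_rfl, le_rfl, hr, by simp⟩
      · exact ⟨L, l, hLR, le_rfl, hr, hl, le_rfl, by simp⟩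
  refine pathLikeSums_mono hL' hLR' hR' ?_
  choose t M h1 h2 h3 h4 using hG l r
  let B : Matrix ι ι (PolyRing k) := Matrix.of fun i j => M i (l, r) j
  let φ : PolyRing k →+* SeriesRing k := MvPolynomial.coeToMvPowerSeries.ringHom
  let c : ι → SeriesRing k := ((1 - B).map φ).mulVec (G l r)
  have hc : ∀ i, c i ∈ pathLikeSums L' R' := by
    intro i
    have hci : c i = t i + ∑ p ∈ Finset.univ.erase (l, r),
        ∑ j, (M i p j : SeriesRing k) * G p.1 p.2 j := by
      have h := h4 i
      rw [← Finset.add_sum_erase _ _ (Finset.mem_univ (l, r))] at h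
      have : c i = G l r i - ∑ j, (M i (l, r) j : SeriesRing k) * G l r j := by
        have hmap : (1 - B).map φ = 1 - B.map φ := by
          ext a b
          simp [Matrix.sub_apply, Matrix.one_apply, apply_ite φ]
        simp only [c, hmap, Matrix.sub_mulVec, Matrix.one_mulVec, Pi.sub_apply]
        rfl
      rw [this]
      linear_combination h
    rw [hci]
    refine Submodule.add_mem _ (coe_mem_pathLikeSums hLR' _) (Submodule.sum_mem _ fun p hp =>
      Submodule.sum_mem _ fun j _ => ?_)
    by_cases hM : M i p j = 0
    · simp [hM]
    by_cases hp12 : p.1 ≤ p.2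
    swap
    · simp [hG0 _ _ _ hp12]
    obtain ⟨h5, h6⟩ := h1 i p j hM
    have hne : ¬ (p.1 = l ∧ p.2 = r) := fun h => Finset.ne_of_mem_erase hp (Prod.ext h.1 h.2)
    rw [← smul_eq_coe_mul]
    refine Submodule.smul_mem _ _ (ih (p.2 - p.1 : ℕ) ?_ hLR' (hlL'.trans h5) (h6.trans hrR') j
      hp12 rfl)
    simp only [Fin.ext_iff, Fin.le_def] at *
    omega
  have hcramer : φ (1 - B).det * G l r i = ∑ j, φ ((1 - B).adjugate i j) * c j := by
    have h : (((1 - B).map φ).adjugate.mulVec c) i = φ (1 - B).det * G l r i := by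
      simp only [c]
      rw [Matrix.mulVec_mulVec, Matrix.adjugate_mul, Matrix.smul_mulVec, Matrix.one_mulVec,
        RingHom.map_det]
      rfl
    rw [← h]
    have hadj : ((1 - B).map φ).adjugate = (1 - B).adjugate.map φ :=
      (RingHom.map_adjugate φ (1 - B)).symm
    rw [hadj]
    rfl
  refine mem_pathLikeSums_of_mul_mem (q := (1 - B).det) ?_ ?_ ?_
  · refine MvPolynomial.supported_mono hsub (det_mem_subalgebra _ fun i j => ?_)
    rw [Matrix.sub_apply]
    refine Subalgebra.sub_mem _ ?_ (h2 i j)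
    rw [Matrix.one_apply]
    split_ifs
    exacts [Subalgebra.one_mem _, Subalgebra.zero_mem _]
  · rw [MvPowerSeries.isUnit_iff_constantCoeff]
    have : MvPowerSeries.constantCoeff ((1 - B).det : SeriesRing k) =
        MvPolynomial.constantCoeff (1 - B).det := by
      rw [← MvPowerSeries.coeff_zero_eq_constantCoeff_apply, MvPolynomial.coeff_coe,
        MvPolynomial.constantCoeff_eq]
    rw [this, RingHom.map_det, map_sub, map_one]
    exact (det_one_sub_ne_zero hE fun i j h => h3 i j h).isUnit
  · change φ (1 - B).det * G l r i ∈ _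
    rw [hcramer]
    refine Submodule.sum_mem _ fun j _ => ?_
    exact Submodule.smul_mem _ ((1 - B).adjugate i j) (hc j)

/-! ### Sorted words -/

/-- The word `w` is sorted, its letters are at least `l`, and the last letter of `l :: w` is `r`;
that is, the deterministic automaton for sorted words, which remembers the last letter read, goes
from state `l` to state `r` on `w`. -/
def Runs {k : ℕ} : List (Fin k) → Fin k → Fin k → Prop
  | [], l, r => l = r
  | a :: w, l, r => l ≤ a ∧ Runs w a r

theorem runs_append {k : ℕ} {u v : List (Fin k)} {l r : Fin k} :
    Runs (u ++ v) l r ↔ ∃ m, Runs u l m ∧ Runs v m r := by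
  induction u generalizing l with
  | nil => simp [Runs]
  | cons a u ih => simp [Runs, ih, and_assoc]

theorem Runs.unique {k : ℕ} {w : List (Fin k)} {l r r' : Fin k} (h : Runs w l r)
    (h' : Runs w l r') : r = r' := by
  induction w generalizing l with
  | nil => exact h.symm.trans h'
  | cons a w ih => exact ih h.2 h'.2

theorem Runs.le {k : ℕ} {w : List (Fin k)} {l r : Fin k} (h : Runs w l r) : l ≤ r := by
  induction w generalizing l with
  | nil => exact le_of_eq h
  | cons a w ih => exact h.1.trans (ih h.2)

theorem Runs.mem_bounds {k : ℕ} {w : List (Fin k)} {l r : Fin k} (h : Runs w l r) {a : Fin k}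
    (ha : a ∈ w) : l ≤ a ∧ a ≤ r := by
  induction w generalizing l with
  | nil => simp at ha
  | cons b w ih =>
    rcases List.mem_cons.1 ha with rfl | ha
    · exact ⟨h.1, h.2.le⟩
    · exact ⟨h.1.trans (ih h.2 ha).1, (ih h.2 ha).2⟩

theorem Runs.sorted {k : ℕ} {w : List (Fin k)} {l r : Fin k} (h : Runs w l r) :
    w.Pairwise (· ≤ ·) := by
  induction w generalizing l with
  | nil => exact List.Pairwise.nil
  | cons a w ih => exact List.Pairwise.cons (fun b hb => (h.2.mem_bounds hb).1) (ih h.2)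

theorem exists_runs {k : ℕ} {w : List (Fin k)} {l : Fin k} (hw : w.Pairwise (· ≤ ·))
    (hl : ∀ a ∈ w, l ≤ a) : ∃ r, Runs w l r := by
  induction w generalizing l with
  | nil => exact ⟨l, rfl⟩
  | cons a w ih =>
    obtain ⟨h1, h2⟩ := List.pairwise_cons.1 hw
    obtain ⟨r, hr⟩ := ih h2 h1
    exact ⟨r, hl a (by simp), hr⟩

/-- The exponent vector of a word: it counts the occurrences of every letter. -/
noncomputable def exponents {k : ℕ} (w : List (Fin k)) : Fin k →₀ ℕ :=
  Multiset.toFinsupp (w : Multiset (Fin k))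

theorem exponents_apply {k : ℕ} (w : List (Fin k)) (i : Fin k) : exponents w i = w.count i := by
  simp [exponents]

theorem exponents_append {k : ℕ} (u v : List (Fin k)) :
    exponents (u ++ v) = exponents u + exponents v := by
  simp [exponents, ← Multiset.coe_add]

theorem exponents_boundedWord {k : ℕ} (n : Fin k →₀ ℕ) : exponents (boundedWord n) = n := by
  ext i
  rw [exponents_apply, boundedWord, List.count_flatMap,
    ← Fin.sum_univ_def (fun a => (List.count i ∘ fun i => List.replicate (n i) i) a)]
  simp [List.count_replicate]

theorem boundedWord_sorted {k : ℕ} (n : Fin k →₀ ℕ) : (boundedWord n).Pairwise (· ≤ ·) := by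
  refine List.pairwise_flatMap.2 ⟨fun a _ => List.pairwise_replicate.2 (Or.inr le_rfl),
    (List.pairwise_lt_finRange k).imp fun hab x hx y hy => ?_⟩
  rw [List.eq_of_mem_replicate hx, List.eq_of_mem_replicate hy]
  exact hab.le

theorem boundedWord_exponents {k : ℕ} {w : List (Fin k)} (hw : w.Pairwise (· ≤ ·)) :
    boundedWord (exponents w) = w := by
  refine List.Perm.eq_of_pairwise' (boundedWord_sorted _) hw (List.perm_iff_count.2 fun a => ?_)
  rw [← exponents_apply, exponents_boundedWord, exponents_apply]

open Classical in
/-- The power series of the words that run from `l` to `r`, where each of them is weighted by `f`.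
A sorted word is determined by its exponent vector. -/
noncomputable def runSeries {k : ℕ} (l r : Fin k) (f : List (Fin k) → ZMod 2) : SeriesRing k :=
  fun n => if Runs (boundedWord n) l r then f (boundedWord n) else 0

open Classical in
theorem coeff_runSeries {k : ℕ} (l r : Fin k) (f : List (Fin k) → ZMod 2) (n : Fin k →₀ ℕ) :
    MvPowerSeries.coeff n (runSeries l r f) =
      if Runs (boundedWord n) l r then f (boundedWord n) else 0 :=
  rfl

theorem runSeries_sum {k : ℕ} {α : Type*} (l r : Fin k) (s : Finset α)
    (f : α → List (Fin k) → ZMod 2) :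
    runSeries l r (fun w => ∑ a ∈ s, f a w) = ∑ a ∈ s, runSeries l r (f a) := by
  ext n
  rw [map_sum, coeff_runSeries]
  simp only [coeff_runSeries]
  split_ifs <;> simp

theorem runSeries_eq_zero {k : ℕ} {l r : Fin k} (h : ¬ l ≤ r) (f : List (Fin k) → ZMod 2) :
    runSeries l r f = 0 := by
  ext n
  rw [coeff_runSeries, if_neg fun hr => h hr.le, map_zero]

/-- A weight concentrated on a single word gives a polynomial. -/
theorem exists_runSeries_eq_coe {k : ℕ} (l r : Fin k) {f : List (Fin k) → ZMod 2}
    {w : List (Fin k)} (hf : ∀ v, f v ≠ 0 → v = w) :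
    ∃ t : PolyRing k, runSeries l r f = t := by
  classical
  refine ⟨MvPolynomial.monomial (exponents w)
    (MvPowerSeries.coeff (exponents w) (runSeries l r f)), ?_⟩
  ext n
  rw [MvPolynomial.coeff_coe, MvPolynomial.coeff_monomial]
  split_ifs with h
  · rw [h]
  · rw [coeff_runSeries]
    split_ifs with hr
    · by_contra h0
      exact h (by rw [← hf _ h0, exponents_boundedWord])
    · rfl

open Classical in
/-- The coefficient with which a subsegment `p` contributes to the words `x ++ u ++ y` that run from
`l` to `r`: the monomial of `x ++ y` if `x` runs from `l` to `p.1` and `y` from `p.2` to `r`. -/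
noncomputable def contextMonomial {k : ℕ} (l r : Fin k) (x y : List (Fin k)) (p : Fin k × Fin k) :
    PolyRing k :=
  if Runs x l p.1 ∧ Runs y p.2 r then MvPolynomial.monomial (exponents (x ++ y)) 1 else 0

theorem contextMonomial_ne_zero {k : ℕ} {l r : Fin k} {x y : List (Fin k)} {p : Fin k × Fin k}
    (h : contextMonomial l r x y p ≠ 0) : l ≤ p.1 ∧ p.2 ≤ r := by
  classical
  rw [contextMonomial, ne_eq, ite_eq_right_iff, Classical.not_imp] at h
  exact ⟨h.1.1.le, h.1.2.le⟩

theorem contextMonomial_mem_supported {k : ℕ} (l r : Fin k) (x y : List (Fin k)) :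
    contextMonomial l r x y (l, r) ∈ MvPolynomial.supported (ZMod 2) {l, r} := by
  classical
  rw [contextMonomial]
  split_ifs with h
  · rw [MvPolynomial.mem_supported, MvPolynomial.vars_monomial one_ne_zero]
    intro a ha
    have ha' : a ∈ x ++ y := by
      rw [Finset.mem_coe, Finsupp.mem_support_iff, exponents_apply] at ha
      exact List.count_pos_iff.1 (Nat.pos_of_ne_zero ha)
    rcases List.mem_append.1 ha' with ha | ha
    · have := h.1.mem_bounds ha
      exact Or.inl (le_antisymm this.2 this.1)
    · have := h.2.mem_bounds ha
      exact Or.inr (le_antisymm this.2 this.1)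
  · exact Subalgebra.zero_mem _

theorem eq_nil_of_constantCoeff_contextMonomial {k : ℕ} {l r : Fin k} {x y : List (Fin k)}
    {p : Fin k × Fin k} (h : MvPolynomial.constantCoeff (contextMonomial l r x y p) ≠ 0) :
    x = [] ∧ y = [] := by
  classical
  rw [contextMonomial] at h
  split_ifs at h
  · rw [MvPolynomial.constantCoeff_monomial, ne_eq, ite_eq_right_iff, Classical.not_imp] at h
    have h0 : x ++ y = [] := by
      by_contra hne
      obtain ⟨a, ha⟩ := List.exists_mem_of_ne_nil _ hne
      have := exponents_apply (x ++ y) a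
      rw [h.1, Finsupp.zero_apply] at this
      exact List.count_eq_zero.1 this.symm ha
    exact List.append_eq_nil_iff.1 h0
  · simp at h

/-- A run on `x ++ u ++ y` splits uniquely into runs on `x`, `u` and `y`. -/
theorem runSeries_context {k : ℕ} (l r : Fin k) (x y : List (Fin k))
    {f g : List (Fin k) → ZMod 2} (hg : ∀ u, g (x ++ u ++ y) = f u)
    (hg0 : ∀ w, g w ≠ 0 → ∃ u, w = x ++ u ++ y) :
    runSeries l r g =
      ∑ p : Fin k × Fin k, (contextMonomial l r x y p : SeriesRing k) * runSeries p.1 p.2 f := by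
  classical
  have hterm : ∀ (p : Fin k × Fin k) (n : Fin k →₀ ℕ),
      MvPowerSeries.coeff n ((contextMonomial l r x y p : SeriesRing k) * runSeries p.1 p.2 f) =
      if Runs x l p.1 ∧ Runs y p.2 r ∧ exponents (x ++ y) ≤ n ∧
          Runs (boundedWord (n - exponents (x ++ y))) p.1 p.2 then
        f (boundedWord (n - exponents (x ++ y))) else 0 := by
    intro p n
    rw [contextMonomial]
    split_ifs with h1 h2 h2
    · rw [MvPolynomial.coe_monomial, MvPowerSeries.coeff_monomial_mul, if_pos h2.2.2.1, one_mul,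
        coeff_runSeries, if_pos h2.2.2.2]
    · rw [MvPolynomial.coe_monomial, MvPowerSeries.coeff_monomial_mul, one_mul, coeff_runSeries]
      split_ifs with h3 h4
      · exact absurd ⟨h1.1, h1.2, h3, h4⟩ h2
      · rfl
      · rfl
    · exact absurd ⟨h2.1, h2.2.1⟩ h1
    · simp
  ext n
  rw [map_sum, Finset.sum_congr rfl fun p _ => hterm p n, coeff_runSeries]
  -- If a summand is nonzero, the sorted word `boundedWord n` splits accordingly.
  have hsplit : ∀ p : Fin k × Fin k, Runs x l p.1 → Runs y p.2 r → exponents (x ++ y) ≤ n →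
      Runs (boundedWord (n - exponents (x ++ y))) p.1 p.2 →
      Runs (boundedWord n) l r ∧
        boundedWord n = x ++ boundedWord (n - exponents (x ++ y)) ++ y := by
    intro p hx hy hle hu
    have hrun : Runs (x ++ boundedWord (n - exponents (x ++ y)) ++ y) l r :=
      runs_append.2 ⟨p.2, runs_append.2 ⟨p.1, hx, hu⟩, hy⟩
    have heq : boundedWord n = x ++ boundedWord (n - exponents (x ++ y)) ++ y := by
      rw [← boundedWord_exponents hrun.sorted]
      congr 1
      rw [exponents_append, exponents_append, exponents_boundedWord, add_right_comm,
        ← exponents_append, add_tsub_cancel_of_le hle]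
    exact ⟨heq ▸ hrun, heq⟩
  by_cases h : Runs (boundedWord n) l r ∧ ∃ u, boundedWord n = x ++ u ++ y
  · obtain ⟨hrun, u, hu⟩ := h
    rw [if_pos hrun]
    have hrun' := hrun
    rw [hu] at hrun'
    obtain ⟨r', hxu, hy⟩ := runs_append.1 hrun'
    obtain ⟨l', hx, hru⟩ := runs_append.1 hxu
    have hn : n = exponents (x ++ y) + exponents u := by
      rw [← exponents_boundedWord n, hu, exponents_append, exponents_append, exponents_append,
        add_right_comm]
    have hsub : n - exponents (x ++ y) = exponents u := by rw [hn, add_tsub_cancel_left]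
    have hle : exponents (x ++ y) ≤ n := hn ▸ le_self_add
    have hbu : boundedWord (n - exponents (x ++ y)) = u := by
      rw [hsub, boundedWord_exponents hru.sorted]
    rw [Finset.sum_eq_single (l', r')]
    · rw [if_pos ⟨hx, hy, hle, by rwa [hbu]⟩, hbu, hu, hg]
    · rintro p - hp
      refine if_neg fun ⟨h1, _, _, h4⟩ => hp ?_
      rw [hbu] at h4
      obtain rfl := h1.unique hx
      exact Prod.ext rfl (h4.unique hru)
    · simp
  · rw [Finset.sum_eq_zero fun p _ => if_neg fun ⟨h1, h2, h3, h4⟩ =>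
      h ⟨(hsplit p h1 h2 h3 h4).1, _, (hsplit p h1 h2 h3 h4).2⟩]
    split_ifs with hrun
    · by_contra h0
      exact h ⟨hrun, hg0 _ h0⟩
    · rfl

/-! ### Parse trees of linear grammars -/

/-- The number of parse forests over `s` with yield `w` (and `0` if there are infinitely many). -/
noncomputable def forestCount {T : Type u} (g : ContextFreeGrammar T)
    (s : List (Symbol T g.NT)) (w : List T) : ℕ :=
  Nat.card {t : ParseForest g s // t.yield = w}

/-- The number of nonterminals in a parse forest. -/
def ParseForest.size {T : Type u} {g : ContextFreeGrammar T} :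
    {s : List (Symbol T g.NT)} → ParseForest g s → ℕ
  | _, .nil => 0
  | _, .terminal _ rest => rest.size
  | _, .nonterminal _ _ _ _ children rest => children.size + rest.size + 1

theorem existsUnique_forest_terminals {T : Type u} (g : ContextFreeGrammar T) (w : List T) :
    ∃ t : ParseForest g (w.map Symbol.terminal),
      t.yield = w ∧ t.size = 0 ∧ ∀ t', t' = t := by
  induction w with
  | nil => exact ⟨.nil, rfl, rfl, fun t' => by cases t'; rfl⟩
  | cons a w ih =>
    obtain ⟨t, h1, h2, h3⟩ := ih
    refine ⟨.terminal a t, by simp [ParseForest.yield, h1], by simp [ParseForest.size, h2],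
      fun t' => ?_⟩
    cases t' with
    | terminal a rest => rw [h3 rest]

/-- Writing the terminal strings `x` and `y` around a tree is a bijection onto the forests over
`x B y`. -/
theorem exists_bijective_context {T : Type u} (g : ContextFreeGrammar T) (x : List T) (B : g.NT)
    (y : List T) {s : List (Symbol T g.NT)}
    (hs : s = x.map Symbol.terminal ++ Symbol.nonterminal B :: y.map Symbol.terminal) :
    ∃ e : ParseForest g [Symbol.nonterminal B] → ParseForest g s, Function.Bijective e ∧
      ∀ t, (e t).yield = x ++ t.yield ++ y ∧ (e t).size = t.size := by
  subst hs
  induction x with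
  | nil =>
    obtain ⟨ty, h1, h2, h3⟩ := existsUnique_forest_terminals g y
    refine ⟨fun t => match t with
      | .nonterminal A r hr hA c .nil => .nonterminal A r hr hA c ty, ⟨?_, ?_⟩, ?_⟩
    · intro t t' h
      cases t with
      | nonterminal A r hr hA c rest =>
      cases rest
      cases t' with
      | nonterminal A' r' hr' hA' c' rest' =>
      cases rest'
      cases h
      rfl
    · intro t
      cases t with
      | nonterminal A r hr hA c rest =>
      obtain rfl := h3 rest
      exact ⟨.nonterminal B r hr hA c .nil, rfl⟩
    · intro t
      cases t with
      | nonterminal A r hr hA c rest =>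
      cases rest
      simp [ParseForest.yield, ParseForest.size, h1, h2]
  | cons a x ih =>
    obtain ⟨e, he, h⟩ := ih
    refine ⟨fun t => .terminal a (e t),
      ⟨fun t t' htt => he.1 (ParseForest.terminal.inj htt), fun t => ?_⟩,
      fun t => by simp [ParseForest.yield, ParseForest.size, h t]⟩
    cases t with
    | terminal a rest =>
      obtain ⟨t, rfl⟩ := he.2 rest
      exact ⟨t, rfl⟩

theorem eq_of_forestCount_terminals {T : Type u} {g : ContextFreeGrammar T} {v w : List T}
    (h : forestCount g (v.map Symbol.terminal) w ≠ 0) : w = v := by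
  obtain ⟨t, h1, _, h3⟩ := existsUnique_forest_terminals g v
  obtain ⟨⟨t', ht'⟩⟩ := (Nat.card_ne_zero.1 h).1
  rw [← ht', h3 t', h1]

theorem forestCount_context {T : Type u} {g : ContextFreeGrammar T} {x : List T} {B : g.NT}
    {y : List T} {s : List (Symbol T g.NT)}
    (hs : s = x.map Symbol.terminal ++ Symbol.nonterminal B :: y.map Symbol.terminal)
    (u : List T) :
    forestCount g s (x ++ u ++ y) = forestCount g [Symbol.nonterminal B] u := by
  obtain ⟨e, he, h⟩ := exists_bijective_context g x B y hs
  refine (Nat.card_congr ((Equiv.ofBijective e he).subtypeEquiv fun t => ?_)).symm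
  rw [Equiv.ofBijective_apply, (h t).1, List.append_left_inj, List.append_right_inj]

theorem eq_of_forestCount_context {T : Type u} {g : ContextFreeGrammar T} {x : List T} {B : g.NT}
    {y : List T} {s : List (Symbol T g.NT)}
    (hs : s = x.map Symbol.terminal ++ Symbol.nonterminal B :: y.map Symbol.terminal)
    {w : List T} (hw : forestCount g s w ≠ 0) : ∃ u, w = x ++ u ++ y := by
  obtain ⟨e, he, h⟩ := exists_bijective_context g x B y hs
  obtain ⟨⟨t', ht'⟩⟩ := (Nat.card_ne_zero.1 hw).1
  obtain ⟨t, rfl⟩ := he.2 t'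
  exact ⟨t.yield, by rw [← ht', (h t).1]⟩

/-- Every string has finitely many parse trees with root `A`. -/
def IsWellFormedAt {T : Type u} (g : ContextFreeGrammar T) (A : g.NT) : Prop :=
  ∀ w : List T, Finite {t : ParseForest g [Symbol.nonterminal A] // t.yield = w}

/-- There is a parse tree with root `A`. -/
def IsProductive {T : Type u} (g : ContextFreeGrammar T) (A : g.NT) : Prop :=
  Nonempty (ParseForest g [Symbol.nonterminal A])

theorem forestCount_eq_zero {T : Type u} {g : ContextFreeGrammar T} {A : g.NT}
    (hA : ¬ IsProductive g A) (w : List T) : forestCount g [Symbol.nonterminal A] w = 0 :=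
  Nat.card_eq_zero.2 (Or.inl ⟨fun t => hA ⟨t.1⟩⟩)

theorem IsProductive.exists_rule {T : Type u} {g : ContextFreeGrammar T} {A : g.NT}
    (hA : IsProductive g A) : ∃ ρ ∈ g.rules, ρ.input = A := by
  obtain ⟨t⟩ := hA
  cases t with
  | nonterminal A r hr hA c rest => exact ⟨r, hr, hA⟩

/-- The parse tree with a given rule at the root. -/
def treeOfRule {T : Type u} {g : ContextFreeGrammar T} {A : g.NT}
    (p : Σ ρ : {ρ : ContextFreeRule T g.NT // ρ ∈ g.rules ∧ ρ.input = A}, ParseForest g ρ.1.output) :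
    ParseForest g [Symbol.nonterminal A] :=
  .nonterminal A p.1.1 p.1.2.1 p.1.2.2 p.2 .nil

theorem treeOfRule_bijective {T : Type u} {g : ContextFreeGrammar T} {A : g.NT} :
    Function.Bijective (treeOfRule (g := g) (A := A)) := by
  constructor
  · rintro ⟨⟨ρ, h1, h2⟩, t⟩ ⟨⟨ρ', h1', h2'⟩, t'⟩ h
    simp only [treeOfRule, ParseForest.nonterminal.injEq] at h
    obtain ⟨rfl, h, -⟩ := h
    rw [heq_eq_eq] at h
    rw [h]
  · intro t
    cases t with
    | nonterminal A r hr hA c rest =>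
    cases rest
    exact ⟨⟨⟨r, hr, hA⟩, c⟩, rfl⟩

theorem treeOfRule_yield {T : Type u} {g : ContextFreeGrammar T} {A : g.NT}
    (p : Σ ρ : {ρ : ContextFreeRule T g.NT // ρ ∈ g.rules ∧ ρ.input = A},
      ParseForest g ρ.1.output) : (treeOfRule p).yield = p.2.yield := by
  simp [treeOfRule, ParseForest.yield]

theorem IsWellFormedAt.finite_forests {T : Type u} {g : ContextFreeGrammar T} {A : g.NT}
    (hA : IsWellFormedAt g A) {ρ : ContextFreeRule T g.NT} (hρ : ρ ∈ g.rules) (hρA : ρ.input = A)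
    (w : List T) : Finite {t : ParseForest g ρ.output // t.yield = w} := by
  have := hA w
  refine Finite.of_injective
    (β := {t : ParseForest g [Symbol.nonterminal A] // t.yield = w})
    (fun t => ⟨treeOfRule ⟨⟨ρ, hρ, hρA⟩, t.1⟩, (treeOfRule_yield _).trans t.2⟩) fun t t' h => ?_
  have h' := treeOfRule_bijective.1 (Subtype.ext_iff.1 h)
  rw [Sigma.mk.injEq] at h'
  exact Subtype.ext (eq_of_heq h'.2)

open Classical in
/-- Parse trees are sorted by the rule at the root. -/
theorem IsWellFormedAt.forestCount_eq_sum {T : Type u} {g : ContextFreeGrammar T} {A : g.NT}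
    (hA : IsWellFormedAt g A) (w : List T) :
    forestCount g [Symbol.nonterminal A] w =
      ∑ ρ ∈ g.rules with ρ.input = A, forestCount g ρ.output w := by
  have hfin : Finite {ρ : ContextFreeRule T g.NT // ρ ∈ g.rules ∧ ρ.input = A} :=
    Finite.of_injective (β := {ρ // ρ ∈ g.rules}) (fun ρ => ⟨ρ.1, ρ.2.1⟩)
      fun ρ ρ' h => Subtype.ext (by simpa using h)
  have := Fintype.ofFinite {ρ : ContextFreeRule T g.NT // ρ ∈ g.rules ∧ ρ.input = A}
  have hfin' (ρ : {ρ : ContextFreeRule T g.NT // ρ ∈ g.rules ∧ ρ.input = A}) :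
      Finite {t : ParseForest g ρ.1.output // t.yield = w} := hA.finite_forests ρ.2.1 ρ.2.2 w
  have e : {t : ParseForest g [Symbol.nonterminal A] // t.yield = w} ≃
      Σ ρ : {ρ : ContextFreeRule T g.NT // ρ ∈ g.rules ∧ ρ.input = A},
        {t : ParseForest g ρ.1.output // t.yield = w} :=
    ((Equiv.ofBijective _ (treeOfRule_bijective (g := g) (A := A))).subtypeEquiv
      (p := fun p => p.2.yield = w) fun p => by
        rw [Equiv.ofBijective_apply, treeOfRule_yield]).symm.trans
      { toFun := fun p => ⟨p.1.1, p.1.2, p.2⟩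
        invFun := fun p => ⟨⟨p.1, p.2.1⟩, p.2.2⟩
        left_inv := fun _ => rfl
        right_inv := fun _ => rfl }
  rw [forestCount, Nat.card_congr e, Nat.card_sigma]
  exact (Finset.sum_subtype (p := fun ρ => ρ ∈ g.rules ∧ ρ.input = A)
    (g.rules.filter fun ρ => ρ.input = A) (by simp) fun ρ => forestCount g ρ.output w).symm

theorem IsWellFormedAt.of_rule {T : Type u} {g : ContextFreeGrammar T} {A : g.NT}
    (hA : IsWellFormedAt g A) {ρ : ContextFreeRule T g.NT} (hρ : ρ ∈ g.rules) (hρA : ρ.input = A)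
    {x : List T} {B : g.NT} {y : List T}
    (hs : ρ.output = x.map Symbol.terminal ++ Symbol.nonterminal B :: y.map Symbol.terminal) :
    IsWellFormedAt g B := by
  intro w
  obtain ⟨e, he, h⟩ := exists_bijective_context g x B y hs
  have := hA.finite_forests hρ hρA (x ++ w ++ y)
  refine Finite.of_injective (β := {t : ParseForest g ρ.output // t.yield = x ++ w ++ y})
    (fun t => ⟨e t.1, by rw [(h t.1).1, t.2]⟩) fun t t' htt => Subtype.ext (he.1 ?_)
  exact Subtype.ext_iff.1 htt

/-- There is a rule `A → B`. -/
def UnitRule {T : Type u} (g : ContextFreeGrammar T) (A B : g.NT) : Prop :=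
  ∃ ρ ∈ g.rules, ρ.input = A ∧ ρ.output = [Symbol.nonterminal B]

theorem UnitRule.exists_larger {T : Type u} {g : ContextFreeGrammar T} {A B : g.NT}
    (h : UnitRule g A B) (t : ParseForest g [Symbol.nonterminal B]) :
    ∃ t' : ParseForest g [Symbol.nonterminal A], t'.yield = t.yield ∧ t.size < t'.size := by
  obtain ⟨ρ, hρ, hA, ho⟩ := h
  obtain ⟨e, -, he⟩ := exists_bijective_context g [] B [] (s := ρ.output) (by simpa using ho)
  refine ⟨treeOfRule ⟨⟨ρ, hρ, hA⟩, e t⟩, ?_, ?_⟩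
  · rw [treeOfRule_yield, (he t).1]
    simp
  · simp [treeOfRule, ParseForest.size, (he t).2]

/-- A cycle of unit rules would give arbitrarily large trees with the same yield. -/
theorem not_transGen_unitRule_self {T : Type u} {g : ContextFreeGrammar T} {A : g.NT}
    (hA : IsWellFormedAt g A) (hA' : IsProductive g A) :
    ¬ Relation.TransGen (UnitRule g) A A := by
  intro hcycle
  have hlarger : ∀ {A B : g.NT}, Relation.TransGen (UnitRule g) A B →
      ∀ t : ParseForest g [Symbol.nonterminal B],
        ∃ t' : ParseForest g [Symbol.nonterminal A], t'.yield = t.yield ∧ t.size < t'.size := by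
    intro A B h
    induction h with
    | single h => exact h.exists_larger
    | tail _ h ih =>
      intro t
      obtain ⟨t', h1, h2⟩ := h.exists_larger t
      obtain ⟨t'', h3, h4⟩ := ih t'
      exact ⟨t'', h3.trans h1, h2.trans h4⟩
  obtain ⟨t₀⟩ := hA'
  have := hA t₀.yield
  have : Nonempty {t : ParseForest g [Symbol.nonterminal A] // t.yield = t₀.yield} := ⟨⟨t₀, rfl⟩⟩
  obtain ⟨t, ht⟩ := Finite.exists_max
    fun t : {t : ParseForest g [Symbol.nonterminal A] // t.yield = t₀.yield} => t.1.size
  obtain ⟨t', h1, h2⟩ := hlarger hcycle t.1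
  exact absurd (ht ⟨t', h1.trans t.2⟩) (not_le.2 h2)

/-- The nonterminals that enter the linear system: those that have parse trees, but finitely many
for every string. -/
abbrev UsefulNT {T : Type u} (g : ContextFreeGrammar T) :=
  {A : g.NT // IsWellFormedAt g A ∧ IsProductive g A}

instance {T : Type u} (g : ContextFreeGrammar T) : Finite (UsefulNT g) := by
  choose ρ hρ hA using fun A : UsefulNT g => A.2.2.exists_rule
  refine Finite.of_injective (β := {ρ // ρ ∈ g.rules}) (fun A => ⟨ρ A, hρ A⟩) fun A B h => ?_
  rw [Subtype.mk.injEq] at h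
  exact Subtype.ext (by rw [← hA A, ← hA B, h])

theorem wellFounded_unitRule {T : Type u} (g : ContextFreeGrammar T) :
    WellFounded fun B A : UsefulNT g => UnitRule g A.1 B.1 := by
  let S : UsefulNT g → UsefulNT g → Prop := fun B A => Relation.TransGen (UnitRule g) A.1 B.1
  have : IsTrans (UsefulNT g) S := ⟨fun _ _ _ h1 h2 => h2.trans h1⟩
  have : Std.Irrefl S := ⟨fun A => not_transGen_unitRule_self A.2.1 A.2.2⟩
  exact Subrelation.wf (fun h => Relation.TransGen.single h)
    (Finite.wellFounded_of_trans_of_irrefl S)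

/-! ### The linear system of a grammar -/

/-- The power series of the parse trees with root `A` whose yields run from `l` to `r`. -/
noncomputable def ntSeries {k : ℕ} (g : ContextFreeGrammar (Fin k)) (l r : Fin k) (A : g.NT) :
    SeriesRing k :=
  runSeries l r fun w => (forestCount g [Symbol.nonterminal A] w : ZMod 2)

theorem hasExpansion_rule {k : ℕ} {g : ContextFreeGrammar (Fin k)} [Fintype (UsefulNT g)]
    (hg : IsLinear g) (l r : Fin k) (A : UsefulNT g) {ρ : ContextFreeRule (Fin k) g.NT}
    (hρ : ρ ∈ g.rules) (hρA : ρ.input = A.1) :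
    HasExpansion (fun l r (B : UsefulNT g) => ntSeries g l r B.1) (fun B => UnitRule g A.1 B.1) l r
      (runSeries l r fun w => (forestCount g ρ.output w : ZMod 2)) := by
  classical
  rcases hg ρ hρ with ⟨w, hw⟩ | ⟨x, B, y, hB⟩
  · obtain ⟨t, ht⟩ := exists_runSeries_eq_coe l r (w := w)
      (f := fun v => (forestCount g ρ.output v : ZMod 2)) fun v hv => by
        rw [hw] at hv
        exact eq_of_forestCount_terminals fun h0 => hv (by rw [h0, Nat.cast_zero])
    rw [ht]
    exact .coe t
  · have hctx := runSeries_context l r x y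
      (f := fun w => (forestCount g [Symbol.nonterminal B] w : ZMod 2))
      (g := fun w => (forestCount g ρ.output w : ZMod 2))
      (fun u => congrArg Nat.cast (forestCount_context hB u))
      fun w hw => eq_of_forestCount_context hB fun h0 => hw (by rw [h0, Nat.cast_zero])
    rw [hctx]
    by_cases hprod : IsProductive g B
    · let B' : UsefulNT g := ⟨B, A.2.1.of_rule hρ hρA hB, hprod⟩
      refine ⟨0, fun p j => if j = B' then contextMonomial l r x y p else 0, fun p j h => ?_,
        fun j => ?_, fun j h => ?_, ?_⟩
      · dsimp only at h
        split_ifs at h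
        · exact contextMonomial_ne_zero h
        · exact absurd rfl h
      · dsimp only
        split_ifs
        · exact contextMonomial_mem_supported l r x y
        · exact Subalgebra.zero_mem _
      · dsimp only at h
        split_ifs at h with hj
        · obtain ⟨rfl, rfl⟩ := eq_nil_of_constantCoeff_contextMonomial h
          exact ⟨ρ, hρ, hρA, by rw [hB, hj]; rfl⟩
        · exact absurd (map_zero _) h
      · rw [MvPolynomial.coe_zero, zero_add]
        refine Finset.sum_congr rfl fun p _ => ?_
        rw [Finset.sum_eq_single B' (fun j _ hj => by simp [hj]) (by simp)]
        simp only [if_true]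
        rfl
    · have hzero : ∀ p : Fin k × Fin k,
          runSeries p.1 p.2 (fun w => (forestCount g [Symbol.nonterminal B] w : ZMod 2)) = 0 := by
        intro p
        ext n
        simp [coeff_runSeries, forestCount_eq_zero hprod]
      simp only [hzero, mul_zero, Finset.sum_const_zero]
      simpa using HasExpansion.coe (k := k) 0

theorem hasExpansion_ntSeries {k : ℕ} {g : ContextFreeGrammar (Fin k)} [Fintype (UsefulNT g)]
    (hg : IsLinear g) (l r : Fin k) (A : UsefulNT g) :
    HasExpansion (fun l r (B : UsefulNT g) => ntSeries g l r B.1) (fun B => UnitRule g A.1 B.1) l r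
      (ntSeries g l r A.1) := by
  classical
  have h : ntSeries g l r A.1 = ∑ ρ ∈ g.rules with ρ.input = A.1,
      runSeries l r fun w => (forestCount g ρ.output w : ZMod 2) := by
    rw [← runSeries_sum, ntSeries]
    congr 1
    funext w
    rw [A.2.1.forestCount_eq_sum w, Nat.cast_sum]
  rw [h]
  refine HasExpansion.sum _ fun ρ hρ => ?_
  rw [Finset.mem_filter] at hρ
  exact hasExpansion_rule hg l r A hρ.1 hρ.2

/-- Every sorted word has exactly one run from the least letter. -/
theorem toSeries_language {k : ℕ} (g : ContextFreeGrammar (Fin k)) {l : Fin k} (hl : (l : ℕ) = 0) :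
    toSeries (language g) = ∑ r, ntSeries g l r g.initial := by
  classical
  ext n
  rw [map_sum]
  obtain ⟨r, hr⟩ := exists_runs (l := l) (boundedWord_sorted n) fun a _ => Fin.le_def.2 (by omega)
  rw [Finset.sum_eq_single r ?_ (by simp)]
  · have hcard : forestCount g [Symbol.nonterminal g.initial] (boundedWord n) =
        (parseTrees g (boundedWord n)).ncard := Nat.card_coe_set_eq _
    rw [ntSeries, coeff_runSeries, if_pos hr, hcard]
    change ite (boundedWord n ∈ language g) (1 : ZMod 2) 0 = _
    split_ifs with h
    · exact (ZMod.natCast_eq_one_iff_odd.2 h).symm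
    · exact (ZMod.natCast_eq_zero_iff_even.2 (Nat.not_odd_iff_even.1 h)).symm
  · rintro r' - hr'
    rw [ntSeries, coeff_runSeries, if_neg fun h => hr' (h.unique hr)]

end GF2

theorem theorem4p1 (k : ℕ) (hk : 2 ≤ k) (K : Language (Fin k))
    (hbounded : K ≤ GF2.boundedLanguage k) (hK : GF2.IsDescribedByLinearGrammar K) :
    ∃ f : Finset (Fin k × Fin k) → MvPowerSeries (Fin k) (ZMod 2),
      (∀ Y ∈ GF2.pathLikeSets k, f Y ∈ GF2.withinv (GF2.polynomials k) Y) ∧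
      GF2.toSeries K = ∑ Y ∈ GF2.pathLikeSets k, f Y := by
  obtain ⟨g, hg, hwf, rfl⟩ := hK
  let L : Fin k := ⟨0, by omega⟩
  let R : Fin k := ⟨k - 1, by omega⟩
  have hLR : L < R := Fin.lt_def.2 (by simp [L, R]; omega)
  have := Fintype.ofFinite (GF2.UsefulNT g)
  refine GF2.exists_withinv_of_mem_pathLikeSums (L := L) (R := R) rfl (by simp [R]; omega) ?_
  rw [GF2.toSeries_language g (l := L) rfl]
  refine Submodule.sum_mem _ fun r _ => ?_
  by_cases hprod : GF2.IsProductive g g.initial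
  · exact GF2.mem_pathLikeSums_of_hasExpansion
      (G := fun l r (B : GF2.UsefulNT g) => GF2.ntSeries g l r B.1) (GF2.wellFounded_unitRule g)
      (fun l r A h => GF2.runSeries_eq_zero h _) (GF2.hasExpansion_ntSeries hg) hLR le_rfl
      (Fin.le_def.2 (by simp [R]; omega)) ⟨g.initial, fun w => (hwf w).to_subtype, hprod⟩
  · have hzero : GF2.ntSeries g L r g.initial = 0 := by
      ext n
      simp [GF2.ntSeries, GF2.coeff_runSeries, GF2.forestCount_eq_zero hprod]
    rw [hzero]
    exact Submodule.zero_mem _
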